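/- Let $\mathcal H$ be a complex Hilbert space, and let $\hat{\mathbb C}=\mathbb C\cup\{\infty\}$ be the extended complex plane with the chordal metric. For subsets $S_k\subseteq\hat{\mathbb C}$, $k=0,1,2,\dots$, put $$\lim_{k\to\infty}S_k:=\{z\in\hat{\mathbb C}: z=\lim_{k\to\infty}z_k \text{ for some sequence with } z_k\in S_k \text{ for all } k\}.$$ For a linear operator $\mathbf T:\mathrm{dom}(\mathbf T)\to\mathcal H$, possibly unbounded, defined on a linear subspace $\mathrm{dom}(\mathbf T)\subseteq\mathcal H$ (not necessarily dense), define its scaled relative graph $$\mathrm{SRG}(\mathbf T):=\left\{\tfrac{\|y\|}{\|u\|}\exp\big(\pm i\angle(u,y)\big): u\in\mathrm{dom}(\mathbf T)\setminus\{0\},\ y=\mathbf Tu\right\}\subseteq\hat{\mathbb C},$$ where $\angle(u,y)\in[0,\pi]$ satisfies $\cos\angle(u,y)=\mathrm{Re}\langle y,u\rangle/(\|y\|\|u\|)$ if $y\neq 0$, and $\angle(u,y)=0$ if $y=0$. Define the maximum and minimum gains $$\overline\sigma(\mathbf T):=\sup_{u\in\mathrm{dom}(\mathbf T),\,u\ne0}\frac{\|\mathbf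 Tu\|}{\|u\|},\qquad \underline\sigma(\mathbf T):=\inf_{u\in\mathrm{dom}(\mathbf T),\,u\ne0}\frac{\|\mathbf Tu\|}{\|u\|}$$ in $[0,\infty]$ (with $\sup\emptyset=0$ and $\inf\emptyset=\infty$), and, for $\alpha\in\mathbb R$, the annulus $$\mathcal A(\mathbf T,\alpha):=\{z\in\hat{\mathbb C}:\underline\sigma(\mathbf T-\alpha\mathbf I)\le|z-\alpha|\le\overline\sigma(\mathbf T-\alpha\mathbf I)\},\qquad |\infty-\alpha|:=\infty.$$ Let $\mathbf T_0,\mathbf T_1,\mathbf T_2,\dots$ be closed linear operators $\mathbf T_k:\mathrm{dom}(\mathbf T_k)\subseteq\mathcal H\to\mathcal H$ such that for every $k$ the graph of $\mathbf T_k$ is contained in the graph of $\mathbf T_{k+1}$. Then $$\lim_{k\to\infty}\mathrm{SRG}(\mathbf T_k)=\bigcap_{\alpha\in\mathbb R}\ \lim_{k\to\infty}\mathcal A(\mathbf T_k,\alpha).$$ -/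

import Mathlib

open Filter Topology
open scoped ENNReal

noncomputable section

namespace SRG

variable {H : Type*} [NormedAddCommGroup H] [InnerProductSpace ℂ H]

/-- The limit of a sequence of subsets: all limits of convergent sequences `x` whose `k`-th term
lies in `S k`. -/
def setLim {X : Type*} [TopologicalSpace X] (S : ℕ → Set X) : Set X :=
  {z | ∃ x : ℕ → X, (∀ k, x k ∈ S k) ∧ Tendsto x atTop (𝓝 z)}

/-- The angle in `[0, π]` with `cos θ = Re ⟪y, u⟫ / (‖y‖ ‖u‖)`, and `0` if `y = 0`. -/
def angle (u y : H) : ℝ :=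
  open Classical in
  if y = 0 then 0 else Real.arccos ((inner ℂ y u).re / (‖y‖ * ‖u‖))

/-- The scaled relative graph of a partially defined linear operator, as a subset of the extended
complex plane `ℂ ∪ {∞}`. -/
def srg (T : H →ₗ.[ℂ] H) : Set (OnePoint ℂ) :=
  {z | ∃ u : T.domain, u ≠ 0 ∧
    (z = ((((‖T u‖ / ‖(u : H)‖ : ℝ) : ℂ) *
        Complex.exp (Complex.I * (angle (u : H) (T u) : ℂ)) : ℂ) : OnePoint ℂ) ∨
     z = ((((‖T u‖ / ‖(u : H)‖ : ℝ) : ℂ) *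
        Complex.exp (-(Complex.I * (angle (u : H) (T u) : ℂ))) : ℂ) : OnePoint ℂ))}

/-- The maximum gain, possibly `∞`. -/
def maxGain (T : H →ₗ.[ℂ] H) : ℝ≥0∞ :=
  ⨆ (u : T.domain) (_ : u ≠ 0), ‖T u‖ₑ / ‖(u : H)‖ₑ

/-- The minimum gain. -/
def minGain (T : H →ₗ.[ℂ] H) : ℝ≥0∞ :=
  ⨅ (u : T.domain) (_ : u ≠ 0), ‖T u‖ₑ / ‖(u : H)‖ₑ

/-- The operator `T - α I`, with the domain of `T`. -/
def shift (T : H →ₗ.[ℂ] H) (α : ℝ) : H →ₗ.[ℂ] H :=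
  T - ((α : ℂ) • (LinearMap.id : H →ₗ[ℂ] H)).toPMap ⊤

/-- The distance `|z - α|` of a point of the extended complex plane to a real number,
equal to `∞` at the point `∞`. -/
def extDist (α : ℝ) (z : OnePoint ℂ) : ℝ≥0∞ :=
  z.elim ⊤ (fun w : ℂ => ‖w - (α : ℂ)‖ₑ)

/-- The closed annulus in the extended complex plane centred at `α`, with inner and outer radii
the minimum and maximum gains of `T - α I`; it contains `∞` when the outer radius is infinite
(and only `∞` when both radii are infinite). -/
def annulus (T : H →ₗ.[ℂ] H) (α : ℝ) : Set (OnePoint ℂ) :=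
  {z | minGain (shift T α) ≤ extDist α z ∧ extDist α z ≤ maxGain (shift T α)}

end SRG

end

/-!
The map `z ↦ (Re z, |z|²)` identifies a scaled relative graph, which is symmetric under conjugation,
with the set of pairs `(Re ⟪Tu, u⟫, ‖Tu‖²) / ‖u‖²` (`coe_mem_srg_iff`). This is the joint range of two
Hermitian forms, so it is convex by the Toeplitz–Hausdorff argument (`convex_gainRange`). Under the
same map the circles centred on the real axis correspond to non-vertical lines, because
`|z - α|² = |z|² - 2 α Re z + α²`; and the gains of `T - α` are the infimum and supremum of the
distance to `α` over the scaled relative graph (`minGain_shift`, `maxGain_shift`). The annuli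
therefore describe the intersection of all closed non-vertical half-planes containing a convex set.

A convex set that lies in the upper half-plane, as this one does, can be separated from a point
outside its closure by a non-vertical line: a vertical separating line can be tilted
(`exists_separating_not_vertical`). So every finite point satisfying all annulus conditions is in
the closure of the scaled relative graph; at `∞` the condition for `α = 0` says that the graph is
unbounded.

For an increasing sequence of operators the argument applies to the union of the graphs, which is
the union of an increasing sequence of convex sets in the `(Re z, |z|²)` plane. Limits of
points of the annuli satisfy the annulus conditions of the union by continuity of the distance to
`α`, and the limit of an increasing sequence of nonempty sets in the first countable space
`OnePoint ℂ` is the closure of the union. If the domain of the first operator is trivial, both sides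
of the equation are empty.
-/

namespace SRG

/-! ### Limits of increasing sequences of sets -/

/-- For an increasing sequence of nonempty sets, the limit contains the closure of the union: one
chooses the `k`-th term in the smallest of the first `k` basic neighbourhoods that meets `S k`. -/
theorem closure_iUnion_subset_setLim {X : Type*} [TopologicalSpace X] [FirstCountableTopology X]
    {S : ℕ → Set X} (hS : Monotone S) (h0 : (S 0).Nonempty) :
    closure (⋃ k, S k) ⊆ setLim S := by
  classical
  intro z hz
  obtain ⟨B, hB⟩ := (𝓝 z).exists_antitone_basis
  let N : ℕ → ℕ := fun k => Nat.findGreatest (fun n => (S k ∩ B n).Nonempty) k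
  have key : ∀ k, ∃ x ∈ S k, (S k ∩ B (N k)).Nonempty → x ∈ B (N k) := by
    intro k
    by_cases h : (S k ∩ B (N k)).Nonempty
    · exact ⟨h.some, h.some_mem.1, fun _ => h.some_mem.2⟩
    · exact ⟨h0.some, hS (Nat.zero_le k) h0.some_mem, fun h' => absurd h' h⟩
  choose x hxS hxB using key
  refine ⟨x, hxS, hB.1.tendsto_right_iff.2 fun n _ => ?_⟩
  obtain ⟨y, hyB, hy⟩ := mem_closure_iff_nhds.1 hz (B n) (hB.1.mem_of_mem trivial)
  obtain ⟨m, hm⟩ := Set.mem_iUnion.1 hy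
  filter_upwards [eventually_ge_atTop (max n m)] with k hk
  have hP : (S k ∩ B n).Nonempty := ⟨y, hS ((le_max_right _ _).trans hk) hm, hyB⟩
  have hnk : n ≤ k := (le_max_left _ _).trans hk
  exact hB.2 (Nat.le_findGreatest hnk hP)
    (hxB k (Nat.findGreatest_spec (P := fun n => (S k ∩ B n).Nonempty) hnk hP))

/-! ### The extended plane -/

theorem firstCountableTopology_onePoint : FirstCountableTopology (OnePoint ℂ) := by
  refine ⟨fun z => ?_⟩
  induction z using OnePoint.rec with
  | infty =>
    have : (coclosedCompact ℂ).IsCountablyGenerated := by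
      rw [coclosedCompact_eq_cocompact, ← Metric.cobounded_eq_cocompact,
        ← comap_norm_atTop]
      infer_instance
    rw [OnePoint.nhds_infty_eq]
    infer_instance
  | coe z =>
    rw [OnePoint.nhds_coe_eq]
    infer_instance

@[simp] theorem extDist_coe (α : ℝ) (z : ℂ) : extDist α (z : OnePoint ℂ) = ‖z - (α : ℂ)‖ₑ := rfl

@[simp] theorem extDist_infty (α : ℝ) : extDist α (OnePoint.infty : OnePoint ℂ) = ⊤ := rfl

theorem tendsto_enorm_sub_cocompact (α : ℝ) :
    Tendsto (fun z : ℂ => ‖z - (α : ℂ)‖ₑ) (cocompact ℂ) (𝓝 ⊤) := by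
  have h : Tendsto (fun z : ℂ => ‖z - (α : ℂ)‖) (cocompact ℂ) atTop :=
    tendsto_atTop_mono (fun z => norm_sub_norm_le z (α : ℂ))
      (tendsto_atTop_add_const_right _ _ tendsto_norm_cocompact_atTop)
  simpa only [Function.comp_def, ofReal_norm] using ENNReal.tendsto_ofReal_atTop.comp h

theorem continuous_extDist (α : ℝ) : Continuous (extDist α) := by
  rw [continuous_iff_continuousAt]
  intro z
  induction z using OnePoint.rec with
  | infty =>
    rw [OnePoint.continuousAt_infty', coclosedCompact_eq_cocompact]
    exact tendsto_enorm_sub_cocompact α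
  | coe z =>
    rw [OnePoint.continuousAt_coe]
    exact (by fun_prop : Continuous fun z : ℂ => ‖z - (α : ℂ)‖ₑ).continuousAt

/-- A set of finite points that is unbounded accumulates at infinity. -/
theorem infty_mem_closure {S : Set (OnePoint ℂ)} (h : (⨆ w ∈ S, extDist 0 w) = ⊤) :
    OnePoint.infty ∈ closure S := by
  by_contra hn
  have hS : IsCompact ((↑) ⁻¹' closure S : Set ℂ) :=
    ((OnePoint.isClosed_iff_of_notMem hn).1 isClosed_closure).2
  obtain ⟨C, hC⟩ := hS.isBounded.exists_norm_le
  refine (lt_of_le_of_lt (iSup₂_le fun w hw => ?_) (ENNReal.ofReal_lt_top (r := C))).ne h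
  induction w using OnePoint.rec with
  | infty => exact absurd (subset_closure hw) hn
  | coe w =>
    rw [extDist_coe, ← ofReal_norm]
    exact ENNReal.ofReal_le_ofReal (by simpa using hC w (subset_closure hw))

/-! ### Convexity of the joint range of two Hermitian forms -/

/-- The Toeplitz–Hausdorff argument: if a sesquilinear form takes a positive and a negative value
on its diagonal, it vanishes at some nonzero diagonal point. After a change of phase of `v` the form
is real along the segment from `u` to `v`. -/
theorem exists_ne_zero_apply_self_eq_zero {V : Type*} [AddCommGroup V] [Module ℂ V]
    (B : V →ₗ⋆[ℂ] V →ₗ[ℂ] ℂ) {u v : V} {s r : ℝ} (hs : 0 < s) (hr : 0 < r)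
    (hu : B u u = s) (hv : B v v = -r) : ∃ x, x ≠ 0 ∧ B x x = 0 := by
  obtain ⟨c, hc, hcd⟩ := RCLike.exists_norm_eq_mul_self (B u v - (starRingEnd ℂ) (B v u))
  have hcc : (starRingEnd ℂ) c * c = 1 := by
    rw [← Complex.normSq_eq_conj_mul_self, Complex.normSq_eq_norm_sq, hc]; simp
  obtain ⟨k, hk⟩ : ∃ k : ℝ, c * B u v + (starRingEnd ℂ) c * B v u = k := by
    refine ⟨(c * B u v + (starRingEnd ℂ) c * B v u).re, Complex.ext (by simp) ?_⟩
    have := congrArg Complex.im hcd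
    simp at this ⊢
    linarith
  have hB : ∀ t : ℝ, B (((1 - t : ℝ) : ℂ) • u + (t : ℂ) • c • v)
      (((1 - t : ℝ) : ℂ) • u + (t : ℂ) • c • v) =
      (((1 - t) ^ 2 * s - t ^ 2 * r + (1 - t) * t * k : ℝ) : ℂ) := by
    intro t
    simp only [map_add, LinearMap.add_apply, map_smul, LinearMap.map_smulₛₗ, LinearMap.smul_apply,
      smul_eq_mul, hu, hv, Complex.conj_ofReal]
    push_cast
    rw [← hk]
    linear_combination (-(t : ℂ) ^ 2 * r) * hcc
  obtain ⟨t, -, ht⟩ : (0 : ℝ) ∈ (fun t : ℝ => (1 - t) ^ 2 * s - t ^ 2 * r + (1 - t) * t * k) ''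
      Set.Icc 0 1 :=
    intermediate_value_Icc' zero_le_one (by fun_prop) ⟨by simp [hr.le], by simp [hs.le]⟩
  refine ⟨_, fun h => ?_, (hB t).trans (congrArg Complex.ofReal ht)⟩
  -- If the combination vanished, `B u u` and `B v v` would be nonnegative multiples of each other.
  have h1 : ((1 - t : ℝ) : ℂ) • u = -((t : ℂ) • c • v) := eq_neg_of_add_eq_zero_left h
  have h2 := congrArg (fun x => B x x) h1
  simp only [map_neg, LinearMap.neg_apply, map_smul, LinearMap.map_smulₛₗ, LinearMap.smul_apply,
    smul_eq_mul, hu, hv, Complex.conj_ofReal] at h2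
  have h3 : (((1 - t) ^ 2 * s : ℝ) : ℂ) = ((-(t ^ 2 * r) : ℝ) : ℂ) := by
    push_cast at h2 ⊢
    linear_combination h2 + (-(t : ℂ) ^ 2 * r) * hcc
  have h4 : (1 - t) ^ 2 * s = -(t ^ 2 * r) := Complex.ofReal_injective h3
  have h5 : 0 ≤ (1 - t) ^ 2 * s := by positivity
  have h6 : 0 ≤ t ^ 2 * r := by positivity
  have h7 : t = 0 := by
    have : t ^ 2 * r = 0 := by linarith
    simpa [hr.ne'] using this
  subst h7
  simp at h4
  exact hs.ne' h4

variable {H : Type*} [NormedAddCommGroup H] [InnerProductSpace ℂ H]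

/-- The set of pairs `(Re ⟪Tu, u⟫ / ‖u‖², ‖Tu‖² / ‖u‖²)`, encoded as complex numbers. It is the image
of the scaled relative graph under `z ↦ (Re z, |z|²)`. -/
def gainRange (T : H →ₗ.[ℂ] H) : Set ℂ :=
  {p | ∃ u : T.domain, u ≠ 0 ∧
    p = ⟨(inner ℂ (T u) (u : H)).re / ‖(u : H)‖ ^ 2, ‖T u‖ ^ 2 / ‖(u : H)‖ ^ 2⟩}

/-- The sesquilinear form on the domain of `T` whose diagonal is
`Re ⟪Tu, u⟫ + i ‖Tu‖² - c ‖u‖²`. -/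
noncomputable def rangeForm (T : H →ₗ.[ℂ] H) (c : ℂ) : T.domain →ₗ⋆[ℂ] T.domain →ₗ[ℂ] ℂ :=
  LinearMap.mk₂'ₛₗ (starRingEnd ℂ) (RingHom.id ℂ)
    (fun x y => (inner ℂ (T x) (y : H) + inner ℂ (x : H) (T y)) / 2 +
      Complex.I * inner ℂ (T x) (T y) - c * inner ℂ (x : H) (y : H))
    (fun x x' y => by simp [LinearPMap.map_add]; ring)
    (fun a x y => by simp [LinearPMap.map_smul]; ring)
    (fun x y y' => by simp [LinearPMap.map_add]; ring)
    (fun a x y => by simp [LinearPMap.map_smul]; ring)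

theorem rangeForm_self (T : H →ₗ.[ℂ] H) (c : ℂ) (x : T.domain) :
    rangeForm T c x x = ⟨(inner ℂ (T x) (x : H)).re, ‖T x‖ ^ 2⟩ - c * (‖(x : H)‖ ^ 2 : ℝ) := by
  have h : rangeForm T c x x = (inner ℂ (T x) (x : H) + inner ℂ (x : H) (T x)) / 2 +
      Complex.I * inner ℂ (T x) (T x) - c * inner ℂ (x : H) (x : H) := rfl
  rw [h, inner_self_eq_norm_sq_to_K, inner_self_eq_norm_sq_to_K, ← inner_conj_symm (x : H) (T x),
    Complex.add_conj]
  congr 1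
  · apply Complex.ext <;> simp [← Complex.ofReal_pow]
  · simp

theorem rangeForm_self_eq_mul (T : H →ₗ.[ℂ] H) (c : ℂ) {x : T.domain} (hx : x ≠ 0) :
    rangeForm T c x x = (⟨(inner ℂ (T x) (x : H)).re / ‖(x : H)‖ ^ 2,
      ‖T x‖ ^ 2 / ‖(x : H)‖ ^ 2⟩ - c) * (‖(x : H)‖ ^ 2 : ℝ) := by
  have hx' : ‖(x : H)‖ ≠ 0 := by simpa using hx
  rw [rangeForm_self, sub_mul]
  congr 1
  apply Complex.ext <;> simp only [Complex.re_mul_ofReal, Complex.im_mul_ofReal] <;> field_simp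

theorem convex_gainRange (T : H →ₗ.[ℂ] H) : Convex ℝ (gainRange T) := by
  rw [convex_iff_pairwise_pos]
  rintro p ⟨u, hu, hp⟩ q ⟨v, hv, hq⟩ hpq a b ha hb hab
  have hw : p - q ≠ 0 := sub_ne_zero.2 hpq
  have hab' : (a : ℂ) + b = 1 := by exact_mod_cast hab
  have hun : 0 < ‖(u : H)‖ ^ 2 := by
    have : 0 < ‖(u : H)‖ := by simpa using hu
    positivity
  have hvn : 0 < ‖(v : H)‖ ^ 2 := by
    have : 0 < ‖(v : H)‖ := by simpa using hv
    positivity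
  -- Rotating and scaling the plane makes the line through `p` and `q` real.
  obtain ⟨x, hx, hx0⟩ := exists_ne_zero_apply_self_eq_zero
    ((p - q)⁻¹ • rangeForm T (a • p + b • q)) (u := u) (v := v)
    (mul_pos hb hun) (mul_pos ha hvn)
    (by
      rw [LinearMap.smul_apply, LinearMap.smul_apply, rangeForm_self_eq_mul T _ hu, ← hp,
        smul_eq_mul, inv_mul_eq_iff_eq_mul₀ hw]
      simp only [Complex.real_smul, Complex.ofReal_mul]
      linear_combination (-p * ((‖(u : H)‖ ^ 2 : ℝ) : ℂ)) * hab')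
    (by
      rw [LinearMap.smul_apply, LinearMap.smul_apply, rangeForm_self_eq_mul T _ hv, ← hq,
        smul_eq_mul, inv_mul_eq_iff_eq_mul₀ hw]
      simp only [Complex.real_smul, Complex.ofReal_mul]
      linear_combination (-q * ((‖(v : H)‖ ^ 2 : ℝ) : ℂ)) * hab')
  refine ⟨x, hx, ?_⟩
  have hxn : ((‖(x : H)‖ ^ 2 : ℝ) : ℂ) ≠ 0 := by simpa using hx
  rw [LinearMap.smul_apply, LinearMap.smul_apply, rangeForm_self_eq_mul T _ hx, smul_eq_mul] at hx0
  have := (mul_eq_zero.1 ((mul_eq_zero.1 hx0).resolve_left (inv_ne_zero hw))).resolve_right hxn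
  exact (sub_eq_zero.1 this).symm

/-! ### The scaled relative graph and its annuli -/

theorem infty_notMem_srg (T : H →ₗ.[ℂ] H) : OnePoint.infty ∉ srg T := by
  rintro ⟨u, -, h | h⟩ <;> exact OnePoint.infty_ne_coe _ h

theorem norm_mul_cos_angle (u y : H) :
    ‖u‖ * (‖y‖ * Real.cos (angle u y)) = (inner ℂ y u).re := by
  unfold angle
  split_ifs with hy
  · simp [hy]
  · rcases eq_or_ne u 0 with rfl | hu
    · simp
    have h : |(inner ℂ y u).re| ≤ ‖y‖ * ‖u‖ :=
      (Complex.abs_re_le_norm _).trans (norm_inner_le_norm y u)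
    have hy' := norm_ne_zero_iff.2 hy
    have hu' := norm_ne_zero_iff.2 hu
    have hpos : 0 < ‖y‖ * ‖u‖ := by positivity
    rw [Real.cos_arccos]
    · field_simp
    · rw [le_div_iff₀ hpos]; linarith [neg_abs_le (inner ℂ y u).re]
    · rw [div_le_one hpos]; exact (le_abs_self _).trans h

/-- A point is determined up to conjugation by its real part and its modulus. -/
theorem eq_mul_exp_or_eq_mul_exp_neg_iff {z : ℂ} {r θ : ℝ} (hr : 0 ≤ r) :
    (z = (r : ℂ) * Complex.exp (Complex.I * θ) ∨ z = (r : ℂ) * Complex.exp (-(Complex.I * θ))) ↔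
      z.re = r * Real.cos θ ∧ ‖z‖ = r := by
  have e1 : (r : ℂ) * Complex.exp (Complex.I * θ) = ⟨r * Real.cos θ, r * Real.sin θ⟩ := by
    rw [mul_comm Complex.I, Complex.exp_mul_I, ← Complex.ofReal_cos, ← Complex.ofReal_sin]
    apply Complex.ext <;> simp [-Complex.ofReal_cos, -Complex.ofReal_sin]
  have e2 : (r : ℂ) * Complex.exp (-(Complex.I * θ)) = ⟨r * Real.cos θ, -(r * Real.sin θ)⟩ := by
    rw [← mul_neg, ← Complex.ofReal_neg, mul_comm Complex.I, Complex.exp_mul_I,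
      ← Complex.ofReal_cos, ← Complex.ofReal_sin]
    apply Complex.ext <;> simp [-Complex.ofReal_cos, -Complex.ofReal_sin]
  rw [e1, e2]
  have hsc := Real.sin_sq_add_cos_sq θ
  have hz : ‖z‖ ^ 2 = z.re ^ 2 + z.im ^ 2 := by
    rw [← Complex.normSq_eq_norm_sq, Complex.normSq_apply]; ring
  constructor
  · intro h
    have h1 : z.re = r * Real.cos θ := by rcases h with h | h <;> rw [h]
    have h2 : z.im ^ 2 = (r * Real.sin θ) ^ 2 := by rcases h with h | h <;> rw [h]; simp
    refine ⟨h1, (sq_eq_sq₀ (norm_nonneg _) hr).1 ?_⟩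
    rw [hz, h1, h2]
    linear_combination r ^ 2 * hsc
  · rintro ⟨h1, h2⟩
    rw [h1, h2] at hz
    have h3 : z.im ^ 2 = (r * Real.sin θ) ^ 2 := by linear_combination -hz - r ^ 2 * hsc
    exact (sq_eq_sq_iff_eq_or_eq_neg.1 h3).imp (Complex.ext h1) (Complex.ext h1)

theorem coe_mem_srg_iff (T : H →ₗ.[ℂ] H) (z : ℂ) :
    (z : OnePoint ℂ) ∈ srg T ↔ (⟨z.re, ‖z‖ ^ 2⟩ : ℂ) ∈ gainRange T := by
  refine exists_congr fun u => and_congr_right fun hu => ?_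
  have hun : 0 < ‖(u : H)‖ := by simpa using hu
  rw [OnePoint.coe_eq_coe, OnePoint.coe_eq_coe,
    eq_mul_exp_or_eq_mul_exp_neg_iff (by positivity), Complex.mk.injEq, ← div_pow,
    sq_eq_sq₀ (norm_nonneg _) (by positivity), ← norm_mul_cos_angle]
  refine and_congr_left fun _ => ?_
  rw [show ‖(u : H)‖ * (‖T u‖ * Real.cos (angle (u : H) (T u))) / ‖(u : H)‖ ^ 2 =
    ‖T u‖ / ‖(u : H)‖ * Real.cos (angle (u : H) (T u)) by field_simp]

theorem re_sq_le_im_of_mem_gainRange {T : H →ₗ.[ℂ] H} {p : ℂ} (hp : p ∈ gainRange T) :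
    p.re ^ 2 ≤ p.im := by
  obtain ⟨u, hu, rfl⟩ := hp
  have hun : 0 < ‖(u : H)‖ := by simpa using hu
  have h : |(inner ℂ (T u) (u : H)).re| ≤ ‖T u‖ * ‖(u : H)‖ :=
    (Complex.abs_re_le_norm _).trans (norm_inner_le_norm _ _)
  have h2 := sq_le_sq' (by linarith [neg_abs_le (inner ℂ (T u) (u : H)).re])
    ((le_abs_self _).trans h)
  simp only
  rw [div_pow, div_le_div_iff₀ (by positivity) (by positivity)]
  calc _ ≤ (‖T u‖ * ‖(u : H)‖) ^ 2 * ‖(u : H)‖ ^ 2 := by gcongr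
    _ = _ := by ring

/-- Every vector of the domain gives a point of the scaled relative graph. -/
theorem exists_coe_mem_srg (T : H →ₗ.[ℂ] H) {u : T.domain} (hu : u ≠ 0) :
    ∃ z : ℂ, (z : OnePoint ℂ) ∈ srg T ∧
      z.re = (inner ℂ (T u) (u : H)).re / ‖(u : H)‖ ^ 2 ∧
      ‖z‖ ^ 2 = ‖T u‖ ^ 2 / ‖(u : H)‖ ^ 2 := by
  have hz : ((((‖T u‖ / ‖(u : H)‖ : ℝ) : ℂ) *
      Complex.exp (Complex.I * (angle (u : H) (T u) : ℂ)) : ℂ) : OnePoint ℂ) ∈ srg T :=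
    ⟨u, hu, Or.inl rfl⟩
  have hun : 0 < ‖(u : H)‖ := by simpa using hu
  obtain ⟨h1, h2⟩ := (eq_mul_exp_or_eq_mul_exp_neg_iff
    (div_nonneg (norm_nonneg (T u)) hun.le)).1 (Or.inl rfl)
  refine ⟨_, hz, ?_, ?_⟩
  · rw [h1, ← norm_mul_cos_angle]
    field_simp
  · rw [h2, div_pow]

theorem norm_sub_ofReal_sq (z : ℂ) (α : ℝ) :
    ‖z - (α : ℂ)‖ ^ 2 = ‖z‖ ^ 2 - 2 * α * z.re + α ^ 2 := by
  simp only [← Complex.normSq_eq_norm_sq, Complex.normSq_apply, Complex.sub_re, Complex.sub_im,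
    Complex.ofReal_re, Complex.ofReal_im]
  ring

theorem enorm_shift_div_eq (α : ℝ) {u y : H} (hu : u ≠ 0) {z : ℂ}
    (h1 : z.re = (inner ℂ y u).re / ‖u‖ ^ 2) (h2 : ‖z‖ ^ 2 = ‖y‖ ^ 2 / ‖u‖ ^ 2) :
    ‖y - (α : ℂ) • u‖ₑ / ‖u‖ₑ = ‖z - (α : ℂ)‖ₑ := by
  have hun : 0 < ‖u‖ := norm_pos_iff.2 hu
  rw [← ofReal_norm, ← ofReal_norm, ← ofReal_norm, ← ENNReal.ofReal_div_of_pos hun]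
  congr 1
  rw [← sq_eq_sq₀ (by positivity) (norm_nonneg _), norm_sub_ofReal_sq, h1, h2, div_pow,
    @norm_sub_sq ℂ, inner_smul_right, norm_smul]
  simp only [Complex.norm_real, Real.norm_eq_abs, mul_pow, sq_abs, RCLike.re_to_complex,
    Complex.re_ofReal_mul]
  field_simp

/-- The gains of `T - α` and the distances from `α` to the scaled relative graph are the same
numbers. -/
theorem exists_shift_gain_iff (T : H →ₗ.[ℂ] H) (α : ℝ) (d : ℝ≥0∞) :
    (∃ u : (shift T α).domain, u ≠ 0 ∧ ‖shift T α u‖ₑ / ‖(u : H)‖ₑ = d) ↔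
      ∃ w ∈ srg T, extDist α w = d := by
  constructor
  · rintro ⟨u, hu, rfl⟩
    have hu' : (⟨u, u.2.1⟩ : T.domain) ≠ 0 := fun h => hu (Subtype.ext (congrArg Subtype.val h :))
    obtain ⟨z, hz, h1, h2⟩ := exists_coe_mem_srg T hu'
    exact ⟨z, hz, (enorm_shift_div_eq α (fun h => hu (Subtype.ext h)) h1 h2).symm⟩
  · rintro ⟨w, hw, rfl⟩
    induction w using OnePoint.rec with
    | infty => exact absurd hw (infty_notMem_srg T)
    | coe z =>
      obtain ⟨u, hu, h⟩ := (coe_mem_srg_iff T z).1 hw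
      rw [Complex.mk.injEq] at h
      exact ⟨⟨u, u.2, trivial⟩, fun h => hu (Subtype.ext (congrArg Subtype.val h :)),
        enorm_shift_div_eq α (fun h => hu (Subtype.ext h)) h.1 h.2⟩

theorem minGain_shift (T : H →ₗ.[ℂ] H) (α : ℝ) :
    minGain (shift T α) = ⨅ w ∈ srg T, extDist α w := by
  apply le_antisymm
  · refine le_iInf₂ fun w hw => ?_
    obtain ⟨u, hu, h⟩ := (exists_shift_gain_iff T α _).2 ⟨w, hw, rfl⟩
    exact h ▸ iInf₂_le u hu
  · refine le_iInf₂ fun u hu => ?_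
    obtain ⟨w, hw, h⟩ := (exists_shift_gain_iff T α _).1 ⟨u, hu, rfl⟩
    exact h ▸ iInf₂_le w hw

theorem maxGain_shift (T : H →ₗ.[ℂ] H) (α : ℝ) :
    maxGain (shift T α) = ⨆ w ∈ srg T, extDist α w := by
  apply le_antisymm
  · refine iSup₂_le fun u hu => ?_
    obtain ⟨w, hw, h⟩ := (exists_shift_gain_iff T α _).1 ⟨u, hu, rfl⟩
    exact h ▸ le_iSup₂ (f := fun w (_ : w ∈ srg T) => extDist α w) w hw
  · refine iSup₂_le fun w hw => ?_
    obtain ⟨u, hu, h⟩ := (exists_shift_gain_iff T α _).2 ⟨w, hw, rfl⟩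
    exact h ▸ le_iSup₂ (f := fun (u : (shift T α).domain) (_ : u ≠ 0) =>
      ‖shift T α u‖ₑ / ‖(u : H)‖ₑ) u hu

theorem srg_subset_annulus (T : H →ₗ.[ℂ] H) (α : ℝ) : srg T ⊆ annulus T α := fun w hw =>
  ⟨(minGain_shift T α).trans_le (iInf₂_le w hw),
    (le_iSup₂ (f := fun w (_ : w ∈ srg T) => extDist α w) w hw).trans_eq (maxGain_shift T α).symm⟩

/-- An operator whose domain is trivial has gains `∞ > 0`, so its annuli are empty. -/
theorem srg_nonempty_of_annulus_nonempty {T : H →ₗ.[ℂ] H} {α : ℝ} (h : (annulus T α).Nonempty) :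
    (srg T).Nonempty := by
  rw [Set.nonempty_iff_ne_empty]
  intro he
  obtain ⟨z, h1, h2⟩ := h
  have := h1.trans h2
  simp [minGain_shift, maxGain_shift, he] at this

theorem gainRange_mono {S T : H →ₗ.[ℂ] H} (h : S ≤ T) : gainRange S ⊆ gainRange T := by
  rintro p ⟨u, hu, rfl⟩
  have hTu : S u = T ⟨u, h.1 u.2⟩ := h.2 rfl
  refine ⟨⟨u, h.1 u.2⟩, fun h0 => hu (Subtype.ext (congrArg Subtype.val h0 :)), ?_⟩
  rw [hTu]

theorem srg_mono {S T : H →ₗ.[ℂ] H} (h : S ≤ T) : srg S ⊆ srg T := by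
  intro z hz
  induction z using OnePoint.rec with
  | infty => exact absurd hz (infty_notMem_srg S)
  | coe z => exact (coe_mem_srg_iff T z).2 (gainRange_mono h ((coe_mem_srg_iff S z).1 hz))

/-! ### Separation from the limit graph -/

/-- Points of the plane are recovered from their image `(Re z, |z|²)` continuously, once the sign
of the imaginary part is fixed. -/
theorem coe_mem_closure_srg {T : ℕ → H →ₗ.[ℂ] H} {z : ℂ}
    (h : (⟨z.re, ‖z‖ ^ 2⟩ : ℂ) ∈ closure (⋃ k, gainRange (T k))) :
    (z : OnePoint ℂ) ∈ closure (⋃ k, srg (T k)) := by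
  obtain ⟨s, hs, hsz⟩ : ∃ s : ℝ, s ^ 2 = 1 ∧ s * |z.im| = z.im := by
    rcases le_total 0 z.im with h | h
    · exact ⟨1, by norm_num, by rw [abs_of_nonneg h, one_mul]⟩
    · exact ⟨-1, by norm_num, by rw [abs_of_nonpos h]; ring⟩
  let g : ℂ → ℂ := fun p => (p.re : ℂ) + (s * √(p.im - p.re ^ 2) : ℝ) * Complex.I
  have hg : Continuous g := by fun_prop
  have hre : ∀ p, (g p).re = p.re := fun p => by simp [g]
  have him : ∀ p, (g p).im = s * √(p.im - p.re ^ 2) := fun p => by simp [g]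
  have hgz : g ⟨z.re, ‖z‖ ^ 2⟩ = z := by
    refine Complex.ext (hre ⟨z.re, ‖z‖ ^ 2⟩) ?_
    rw [him, ← Complex.normSq_eq_norm_sq, Complex.normSq_apply]
    simp only
    rw [show z.re * z.re + z.im * z.im - z.re ^ 2 = z.im ^ 2 by ring, Real.sqrt_sq_eq_abs, hsz]
  rw [← hgz]
  refine map_mem_closure (f := fun p => (g p : OnePoint ℂ)) (OnePoint.continuous_coe.comp hg) h ?_
  intro p hp
  obtain ⟨k, hk⟩ := Set.mem_iUnion.1 hp
  refine Set.mem_iUnion.2 ⟨k, (coe_mem_srg_iff _ _).2 ?_⟩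
  suffices him2 : ‖g p‖ ^ 2 = p.im by rwa [hre, him2]
  rw [← Complex.normSq_eq_norm_sq, Complex.normSq_apply, hre, him, mul_mul_mul_comm, ← sq s, hs,
    Real.mul_self_sqrt (sub_nonneg.2 (re_sq_le_im_of_mem_gainRange hk))]
  ring

/-- A point outside the closure of a convex subset of the upper half-plane is separated from it by a
non-vertical line. -/
theorem exists_separating_not_vertical {W : Set ℂ} (hW : Convex ℝ W) (him : ∀ w ∈ W, 0 ≤ w.im)
    {p : ℂ} (hp : p ∉ closure W) :
    ∃ β γ c : ℝ, γ ≠ 0 ∧ β * p.re + γ * p.im < c ∧ ∀ w ∈ W, c < β * w.re + γ * w.im := by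
  obtain ⟨f, c, hfp, hfW⟩ := geometric_hahn_banach_point_closed hW.closure isClosed_closure hp
  have hf : ∀ w : ℂ, f w = f 1 * w.re + f Complex.I * w.im := by
    intro w
    have : w = w.re • (1 : ℂ) + w.im • Complex.I := by simp
    conv_lhs => rw [this]
    rw [map_add, map_smul, map_smul, smul_eq_mul, smul_eq_mul]
    ring
  rw [hf] at hfp
  have hfW' : ∀ w ∈ W, c < f 1 * w.re + f Complex.I * w.im :=
    fun w hw => hf w ▸ hfW w (subset_closure hw)
  by_cases h0 : f Complex.I = 0
  · -- A vertical line can be tilted slightly, since `W` lies above the real axis.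
    simp only [h0, zero_mul, add_zero] at hfp hfW'
    have hpos : 0 < c - f 1 * p.re := sub_pos.2 hfp
    have hden : 0 < |p.im| + 1 := by positivity
    refine ⟨f 1, (c - f 1 * p.re) / (|p.im| + 1), c, (div_pos hpos hden).ne', ?_, fun w hw => ?_⟩
    · have : (c - f 1 * p.re) / (|p.im| + 1) * p.im < c - f 1 * p.re := by
        rw [div_mul_eq_mul_div, div_lt_iff₀ hden]
        exact mul_lt_mul_of_pos_left ((le_abs_self _).trans_lt (lt_add_one _)) hpos
      linarith
    · have := mul_nonneg (div_pos hpos hden).le (him w hw)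
      linarith [hfW' w hw]
  · exact ⟨f 1, f Complex.I, c, h0, hfp, hfW'⟩

theorem lt_iInf_extDist {S : Set (OnePoint ℂ)} {z : ℂ} {α c : ℝ} (hz : ‖z - (α : ℂ)‖ ^ 2 < c)
    (hS : ∀ w : ℂ, (w : OnePoint ℂ) ∈ S → c < ‖w - (α : ℂ)‖ ^ 2) :
    extDist α z < ⨅ w ∈ S, extDist α w := by
  have hlt : ‖z - (α : ℂ)‖ < √c := Real.lt_sqrt_of_sq_lt hz
  refine lt_of_lt_of_le (b := ENNReal.ofReal √c) ?_ (le_iInf₂ fun w hw => ?_)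
  · rw [extDist_coe, ← ofReal_norm]
    exact (ENNReal.ofReal_lt_ofReal_iff ((norm_nonneg _).trans_lt hlt)).2 hlt
  · induction w using OnePoint.rec with
    | infty => exact le_top
    | coe w =>
      rw [extDist_coe, ← ofReal_norm]
      exact ENNReal.ofReal_le_ofReal (Real.sqrt_le_iff.2 ⟨norm_nonneg _, (hS w hw).le⟩)

theorem iSup_extDist_lt {S : Set (OnePoint ℂ)} (hinf : OnePoint.infty ∉ S) {z : ℂ} {α c : ℝ}
    (hz : c < ‖z - (α : ℂ)‖ ^ 2) (hne : S.Nonempty)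
    (hS : ∀ w : ℂ, (w : OnePoint ℂ) ∈ S → ‖w - (α : ℂ)‖ ^ 2 < c) :
    ⨆ w ∈ S, extDist α w < extDist α z := by
  have hc : 0 ≤ c := by
    obtain ⟨w, hw⟩ := hne
    induction w using OnePoint.rec with
    | infty => exact absurd hw hinf
    | coe w => exact (sq_nonneg _).trans (hS w hw).le
  have hlt : √c < ‖z - (α : ℂ)‖ := by
    rw [Real.sqrt_lt' ?_]
    · exact hz
    · exact (norm_nonneg _).lt_of_ne fun h => by rw [← h] at hz; norm_num at hz; linarith
  refine lt_of_le_of_lt (b := ENNReal.ofReal √c) (iSup₂_le fun w hw => ?_) ?_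
  · induction w using OnePoint.rec with
    | infty => exact absurd hw hinf
    | coe w =>
      rw [extDist_coe, ← ofReal_norm]
      exact ENNReal.ofReal_le_ofReal (Real.le_sqrt_of_sq_le (hS w hw).le)
  · rw [extDist_coe, ← ofReal_norm]
    exact (ENNReal.ofReal_lt_ofReal_iff ((Real.sqrt_nonneg _).trans_lt hlt)).2 hlt

/-- A point whose distance to every real `α` lies between the extreme distances from `α` to the
graphs is in the closure of their union: a line `β x + γ y = c` in the plane of pairs
`(Re z, |z|²)` with `γ ≠ 0` corresponds to a circle centred at `-β / (2γ)`. -/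
theorem mem_closure_of_forall_extDist {T : ℕ → H →ₗ.[ℂ] H} (hT : Monotone T)
    (hne : (⋃ k, srg (T k)).Nonempty) {z : OnePoint ℂ}
    (hlow : ∀ α, ⨅ w ∈ ⋃ k, srg (T k), extDist α w ≤ extDist α z)
    (hup : ∀ α, extDist α z ≤ ⨆ w ∈ ⋃ k, srg (T k), extDist α w) :
    z ∈ closure (⋃ k, srg (T k)) := by
  have hinf : OnePoint.infty ∉ ⋃ k, srg (T k) := by
    simpa using fun k => infty_notMem_srg (T k)
  induction z using OnePoint.rec with
  | infty => exact infty_mem_closure (top_le_iff.1 (hup 0))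
  | coe z =>
    refine coe_mem_closure_srg ?_
    by_contra hp
    have hconv : Convex ℝ (⋃ k, gainRange (T k)) :=
      Directed.convex_iUnion (Monotone.directed_le fun i j hij => gainRange_mono (hT hij))
        fun {k} => convex_gainRange (T k)
    have him : ∀ w ∈ ⋃ k, gainRange (T k), 0 ≤ w.im := by
      intro w hw
      obtain ⟨k, hk⟩ := Set.mem_iUnion.1 hw
      exact (sq_nonneg _).trans (re_sq_le_im_of_mem_gainRange hk)
    obtain ⟨β, γ, c, hγ, hz, hS⟩ := exists_separating_not_vertical hconv him hp
    have hS' : ∀ w : ℂ, (w : OnePoint ℂ) ∈ ⋃ k, srg (T k) → c < β * w.re + γ * ‖w‖ ^ 2 := by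
      intro w hw
      obtain ⟨k, hk⟩ := Set.mem_iUnion.1 hw
      exact hS _ (Set.mem_iUnion.2 ⟨k, (coe_mem_srg_iff _ _).1 hk⟩)
    simp only at hz
    -- Completing the square turns the linear functional into a squared distance.
    have hsq : ∀ w : ℂ, ‖w - ((-β / (2 * γ) : ℝ) : ℂ)‖ ^ 2 =
        (β * w.re + γ * ‖w‖ ^ 2) / γ + (-β / (2 * γ)) ^ 2 := by
      intro w
      rw [norm_sub_ofReal_sq]
      field_simp
      ring
    rcases hγ.lt_or_gt with hneg | hpos
    · refine (hup (-β / (2 * γ))).not_gt (iSup_extDist_lt (c := c / γ + (-β / (2 * γ)) ^ 2)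
        hinf ?_ hne fun w hw => ?_)
      · rw [hsq]
        exact add_lt_add_left (div_lt_div_of_neg_of_lt hneg hz) _
      · rw [hsq]
        exact add_lt_add_left (div_lt_div_of_neg_of_lt hneg (hS' w hw)) _
    · refine (hlow (-β / (2 * γ))).not_gt (lt_iInf_extDist (c := c / γ + (-β / (2 * γ)) ^ 2)
        ?_ fun w hw => ?_)
      · rw [hsq]
        gcongr
      · rw [hsq]
        gcongr
        exact hS' w hw

end SRG

theorem theorem2 {H : Type*} [NormedAddCommGroup H] [InnerProductSpace ℂ H] [CompleteSpace H]
    (T : ℕ → (H →ₗ.[ℂ] H)) (hclosed : ∀ k, (T k).IsClosed)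
    (hmono : ∀ k, (T k).graph ≤ (T (k + 1)).graph) :
    SRG.setLim (fun k => SRG.srg (T k)) =
      ⋂ α : ℝ, SRG.setLim (fun k => SRG.annulus (T k) α) := by
  have hT : Monotone T := monotone_nat_of_le_succ fun k => LinearPMap.le_of_le_graph (hmono k)
  apply Set.Subset.antisymm
  · rintro z ⟨x, hx, hz⟩
    exact Set.mem_iInter.2 fun α => ⟨x, fun k => SRG.srg_subset_annulus (T k) α (hx k), hz⟩
  · intro z hz
    rw [Set.mem_iInter] at hz
    have hne : (SRG.srg (T 0)).Nonempty := by
      obtain ⟨x, hx, -⟩ := hz 0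
      exact SRG.srg_nonempty_of_annulus_nonempty ⟨x 0, hx 0⟩
    have := SRG.firstCountableTopology_onePoint
    refine SRG.closure_iUnion_subset_setLim (fun i j hij => SRG.srg_mono (hT hij)) hne
      (SRG.mem_closure_of_forall_extDist hT (hne.mono (Set.subset_iUnion _ 0))
        (fun α => ?_) (fun α => ?_))
    · obtain ⟨x, hx, hxz⟩ := hz α
      refine ge_of_tendsto ((SRG.continuous_extDist α).continuousAt.tendsto.comp hxz)
        (Eventually.of_forall fun k => le_trans ?_ (hx k).1)
      rw [SRG.minGain_shift]
      exact biInf_mono (Set.subset_iUnion (fun k => SRG.srg (T k)) k)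
    · obtain ⟨x, hx, hxz⟩ := hz α
      refine le_of_tendsto ((SRG.continuous_extDist α).continuousAt.tendsto.comp hxz)
        (Eventually.of_forall fun k => (hx k).2.trans ?_)
      rw [SRG.maxGain_shift]
      exact biSup_mono (Set.subset_iUnion (fun k => SRG.srg (T k)) k)
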